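/- Let $\varphi:[0,\infty)\to[0,\infty)$ be a convex $\varphi$-function (continuous, nondecreasing, unbounded, convex, with $\varphi(u)=0$ iff $u=0$) satisfying the Orlicz condition at infinity $\varphi(u)/u\to\infty$ as $u\to\infty$, and let $a<b$ be real numbers. For $\lambda>0$ and $x,y:[a,b]\to\mathbb R$ put $$w_\lambda(x,y)=\sup_\pi\sum_{i=1}^m\varphi\left(\frac{|x(t_i)+y(t_{i-1})-x(t_{i-1})-y(t_i)|}{\lambda\,(t_i-t_{i-1})}\right)(t_i-t_{i-1})\in[0,\infty],$$ where the supremum is over all partitions $\pi:\ a=t_0<t_1<\dots<t_m=b$, $m\ge1$. For $x_0\in\mathbb R$ (also regarded as a constant function on $[a,b]$) let $$X_w^*=\{x:[a,b]\to\mathbb R \;:\; x(a)=x_0 \text{ and } w_\lambda(x,x_0)<\infty\text{ for some }\lambda>0\},$$ that is, $X_w^*=\{x\in GV_\varphi[a,b]: x(a)=x_0\}$. Let $f:[a,b]\times\mathbb R\to\mathbb R$ satisfy: (C.1) for each $x\in\mathbb R$ the function $f(\cdot,x)$ is Lebesgue measurable on $[a,b]$, and there is $y_0\in\mathbb R$ with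 $f(\cdot,y_0)\in L^\varphi[a,b]$, i.e. $\int_a^b\varphi(|f(t,y_0)|/\lambda)\,dt<\infty$ for some $\lambda>0$; (C.2) there is a constant $L>0$ such that, for almost all $t\in[a,b]$, $|f(t,x)-f(t,y)|\le L|x-y|$ for all $x,y\in\mathbb R$. Then for every $x\in X_w^*$ the function $s\mapsto f(s,x(s))$ is Lebesgue integrable on $[a,b]$, so that the operator $$(Tx)(t)=x_0+\int_a^t f(s,x(s))\,ds,\qquad x\in X_w^*,\ t\in[a,b],$$ is well defined; $T$ maps $X_w^*$ into itself; and, with $L$ the constant of (C.2), $$w_{L(b-a)\lambda}(Tx,Ty)\le w_\lambda(x,y)\quad\text{in }[0,\infty]\qquad\text{for all }\lambda>0\text{ and }x,y\in X_w^*.$$ -/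

import Mathlib

open MeasureTheory Set Filter
open scoped ENNReal

/-- `φ : [0,∞) → [0,∞)` is a convex `φ`-function: it is continuous, nondecreasing, unbounded,
vanishes only at zero, and is convex. Only the values of `φ` on `[0,∞)` matter. -/
structure IsConvexPhiFunction (φ : ℝ → ℝ) : Prop where
  nonneg : ∀ u, 0 ≤ u → 0 ≤ φ u
  continuousOn : ContinuousOn φ (Ici 0)
  monotoneOn : MonotoneOn φ (Ici 0)
  unbounded : Tendsto φ atTop atTop
  eq_zero_iff : ∀ u, 0 ≤ u → (φ u = 0 ↔ u = 0)
  convexOn : ConvexOn ℝ (Ici 0) φ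

/-- The Orlicz condition at infinity: `φ(u)/u → ∞` as `u → ∞`. -/
def OrliczAtInfinity (φ : ℝ → ℝ) : Prop :=
  Tendsto (fun u => φ u / u) atTop atTop

/-- `a = t 0 < t 1 < ⋯ < t m = b` is a partition of `[a,b]`
(the values of `t` beyond the index `m` are irrelevant). -/
structure IsPartitionOf (a b : ℝ) (m : ℕ) (t : ℕ → ℝ) : Prop where
  left : t 0 = a
  right : t m = b
  lt : ∀ i < m, t i < t (i + 1)

/-- The generalized `φ`-variation modular `w_l(x,y)` on `[a,b]`, for `l > 0`: the supremum over
all partitions `a = t₀ < ⋯ < t_m = b` of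
`∑ φ(|x(t_i) + y(t_{i-1}) - (x(t_{i-1}) + y(t_i))| / (l (t_i - t_{i-1}))) (t_i - t_{i-1})`.
Functions on `[a,b]` are given by total functions of which only the values on `[a,b]` are used. -/
noncomputable def phiVarModular (φ : ℝ → ℝ) (a b : ℝ) (l : ℝ) (x y : ℝ → ℝ) : ℝ≥0∞ :=
  ⨆ (m : ℕ) (t : ℕ → ℝ) (_ : IsPartitionOf a b m t),
    ∑ i ∈ Finset.range m,
      ENNReal.ofReal
        (φ (|(x (t (i + 1)) + y (t i)) - (x (t i) + y (t (i + 1)))| / (l * (t (i + 1) - t i)))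
          * (t (i + 1) - t i))

/-- The modular space `X_w^*` around `x₀` of a family `w_l : X × X → [0,∞]`, `l > 0`. -/
def modularSpaceStar {X : Type*} (w : ℝ → X → X → ℝ≥0∞) (x₀ : X) : Set X :=
  {x | ∃ l : ℝ, 0 < l ∧ w l x x₀ < ∞}

/-- `{x ∈ GV_φ[a,b] : x(a) = x₀}`, where `GV_φ[a,b]` is the modular space of `phiVarModular`
around the constant function `x₀`. -/
def GVPhiAt (φ : ℝ → ℝ) (a b x₀ : ℝ) : Set (ℝ → ℝ) :=
  {x | x ∈ modularSpaceStar (phiVarModular φ a b) (fun _ => x₀) ∧ x a = x₀}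

/-- The Orlicz modular `ρ(z) = ∫_a^b φ(|z(t)|) dt ∈ [0,∞]`. -/
noncomputable def orliczModular (φ : ℝ → ℝ) (a b : ℝ) (z : ℝ → ℝ) : ℝ≥0∞ :=
  ∫⁻ t in Icc a b, ENNReal.ofReal (φ |z t|)

/-- Membership in the Orlicz space `L^φ[a,b]`: Lebesgue measurable on `[a,b]`, with
`ρ(z/l) < ∞` for some `l > 0`. -/
def MemOrlicz (φ : ℝ → ℝ) (a b : ℝ) (z : ℝ → ℝ) : Prop :=
  AEMeasurable z (volume.restrict (Icc a b)) ∧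
    ∃ l : ℝ, 0 < l ∧ orliczModular φ a b (fun t => z t / l) < ∞

/-- The integral operator `(Tx)(t) = x₀ + ∫_a^t f(s, x(s)) ds`. -/
noncomputable def integralOp (f : ℝ → ℝ → ℝ) (a x₀ : ℝ) (x : ℝ → ℝ) : ℝ → ℝ :=
  fun t => x₀ + ∫ s in a..t, f s (x s)

namespace IsConvexPhiFunction

variable {φ : ℝ → ℝ}

theorem map_zero (hφ : IsConvexPhiFunction φ) : φ 0 = 0 :=
  (hφ.eq_zero_iff 0 le_rfl).2 rfl

theorem continuous_comp_abs (hφ : IsConvexPhiFunction φ) : Continuous fun u : ℝ => φ |u| :=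
  hφ.continuousOn.comp_continuous continuous_abs fun u => abs_nonneg u

theorem convexOn_comp_abs (hφ : IsConvexPhiFunction φ) :
    ConvexOn ℝ univ fun u : ℝ => φ |u| := by
  refine ⟨convex_univ, fun u _ v _ p q hp hq hpq => ?_⟩
  refine (hφ.monotoneOn (mem_Ici.2 (abs_nonneg _)) (?_ : (0 : ℝ) ≤ p • |u| + q • |v|) ?_).trans
    (hφ.convexOn.2 (abs_nonneg u) (abs_nonneg v) hp hq hpq)
  · simp only [smul_eq_mul]; positivity
  · simp only [smul_eq_mul]
    refine (abs_add_le _ _).trans ?_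
    rw [abs_mul, abs_mul, abs_of_nonneg hp, abs_of_nonneg hq]

theorem map_mul_le (hφ : IsConvexPhiFunction φ) {r u : ℝ} (hr : 0 ≤ r) (hr1 : r ≤ 1)
    (hu : 0 ≤ u) : φ (r * u) ≤ r * φ u := by
  have h := hφ.convexOn.2 (x := u) (y := 0) hu self_mem_Ici hr (sub_nonneg.2 hr1) (by ring)
  simpa [hφ.map_zero] using h

theorem exists_le_mul_add (hφ : IsConvexPhiFunction φ) (hO : OrliczAtInfinity φ) {ε : ℝ}
    (hε : 0 < ε) : ∃ C : ℝ, 0 ≤ C ∧ ∀ u, 0 ≤ u → u ≤ ε * φ u + C := by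
  obtain ⟨M, hM⟩ := eventually_atTop.1 (hO.eventually_ge_atTop ε⁻¹)
  refine ⟨max M 0, le_max_right _ _, fun u hu => ?_⟩
  have hφu := mul_nonneg hε.le (hφ.nonneg u hu)
  rcases le_or_gt u (max M 0) with h | h
  · linarith
  · have hu0 : 0 < u := (le_max_right _ _).trans_lt h
    have h1 := hM u ((le_max_left _ _).trans h.le)
    rw [le_div_iff₀ hu0, inv_mul_le_iff₀ hε] at h1
    linarith [le_max_right M 0]

end IsConvexPhiFunction

theorem exists_isPartitionOf_consecutive {a b c d : ℝ} (hac : a ≤ c) (hcd : c < d)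
    (hdb : d ≤ b) :
    ∃ (m : ℕ) (t : ℕ → ℝ) (i : ℕ), IsPartitionOf a b m t ∧ i < m ∧ t i = c ∧ t (i + 1) = d := by
  rcases hac.eq_or_lt with rfl | hac <;> rcases hdb.eq_or_lt with rfl | hdb
  · refine ⟨1, fun i => if i = 0 then a else d, 0, ⟨by simp, by simp, fun i hi => ?_⟩,
      by simp, by simp, by simp⟩
    interval_cases i; simpa
  · refine ⟨2, fun i => if i = 0 then a else if i = 1 then d else b, 0,
      ⟨by simp, by simp, fun i hi => ?_⟩, by simp, by simp, by simp⟩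
    interval_cases i <;> simpa
  · refine ⟨2, fun i => if i = 0 then a else if i = 1 then c else d, 1,
      ⟨by simp, by simp, fun i hi => ?_⟩, by simp, by simp, by simp⟩
    interval_cases i <;> simpa
  · refine ⟨3, fun i => if i = 0 then a else if i = 1 then c else if i = 2 then d else b, 1,
      ⟨by simp, by simp, fun i hi => ?_⟩, by simp, by simp, by simp⟩
    interval_cases i <;> simpa

theorem IsPartitionOf.left_le {a b : ℝ} {m : ℕ} {t : ℕ → ℝ} (h : IsPartitionOf a b m t) :
    ∀ i ≤ m, a ≤ t i := by
  intro i
  induction i with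
  | zero => exact fun _ => h.left.ge
  | succ k ih => exact fun hk => (ih (by omega)).trans (h.lt k (by omega)).le

theorem IsPartitionOf.le_right {a b : ℝ} {m : ℕ} {t : ℕ → ℝ} (h : IsPartitionOf a b m t)
    {i : ℕ} (hi : i ≤ m) : t i ≤ b := by
  induction hi using Nat.decreasingInduction with
  | self => exact h.right.le
  | of_succ k hk ih => exact (h.lt k hk).le.trans ih

theorem IsPartitionOf.sum_setLIntegral {a b : ℝ} {m : ℕ} {t : ℕ → ℝ}
    (h : IsPartitionOf a b m t) (F : ℝ → ℝ≥0∞) :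
    ∑ i ∈ Finset.range m, ∫⁻ s in Ioc (t i) (t (i + 1)), F s = ∫⁻ s in Ioc a b, F s := by
  have key : ∀ k ≤ m, ∑ i ∈ Finset.range k, ∫⁻ s in Ioc (t i) (t (i + 1)), F s
      = ∫⁻ s in Ioc a (t k), F s := by
    intro k
    induction k with
    | zero => simp [h.left]
    | succ k ih =>
      intro hk
      rw [Finset.sum_range_succ, ih (by omega),
        ← Ioc_union_Ioc_eq_Ioc (h.left_le k (by omega)) (h.lt k (by omega)).le,
        lintegral_union measurableSet_Ioc (Ioc_disjoint_Ioc_of_le le_rfl)]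
  rw [key m le_rfl, h.right]

/-- Every pair of points of `[a,b]` gives a lower bound for the modular. -/
theorem le_phiVarModular {φ : ℝ → ℝ} {a b c d : ℝ} (hac : a ≤ c) (hcd : c < d) (hdb : d ≤ b)
    (l : ℝ) (x y : ℝ → ℝ) :
    ENNReal.ofReal (φ (|(x d + y c) - (x c + y d)| / (l * (d - c))) * (d - c))
      ≤ phiVarModular φ a b l x y := by
  obtain ⟨m, t, i, ht, hi, rfl, rfl⟩ := exists_isPartitionOf_consecutive hac hcd hdb
  unfold phiVarModular
  refine le_trans ?_ (le_iSup_of_le m (le_iSup_of_le t (le_iSup_of_le ht le_rfl)))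
  exact Finset.single_le_sum (f := fun i => ENNReal.ofReal
      (φ (|(x (t (i + 1)) + y (t i)) - (x (t i) + y (t (i + 1)))| / (l * (t (i + 1) - t i)))
          * (t (i + 1) - t i))) (fun _ _ => zero_le) (Finset.mem_range.2 hi)

/-- A function of finite modular satisfies a uniform continuity estimate. -/
theorem exists_abs_sub_le_of_phiVarModular_lt_top {φ : ℝ → ℝ} (hφ : IsConvexPhiFunction φ)
    (hO : OrliczAtInfinity φ) {a b l x₀ : ℝ} (hl : 0 < l) {x : ℝ → ℝ}
    (hx : phiVarModular φ a b l x (fun _ => x₀) < ∞) {ε : ℝ} (hε : 0 < ε) :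
    ∃ C : ℝ, 0 ≤ C ∧ ∀ c ∈ Icc a b, ∀ d ∈ Icc a b, |x d - x c| ≤ ε + C * |d - c| := by
  set W := (phiVarModular φ a b l x (fun _ => x₀)).toReal with hW
  have hW0 : 0 ≤ W := ENNReal.toReal_nonneg
  obtain ⟨C, hC, hCu⟩ := hφ.exists_le_mul_add hO (ε := ε / (l * (W + 1))) (by positivity)
  have key : ∀ c d, a ≤ c → c < d → d ≤ b → |x d - x c| ≤ ε + l * C * |d - c| := by
    intro c d hac hcd hdb
    have hdc : 0 < d - c := sub_pos.2 hcd
    have h1 := le_phiVarModular (φ := φ) hac hcd hdb l x (fun _ => x₀)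
    rw [← ENNReal.ofReal_toReal hx.ne, ENNReal.ofReal_le_ofReal_iff hW0,
      add_sub_add_right_eq_sub] at h1
    have h2 := hCu (|x d - x c| / (l * (d - c))) (by positivity)
    set u := |x d - x c| / (l * (d - c)) with hu
    have h3 : |x d - x c| = u * (l * (d - c)) := by
      rw [hu]; field_simp
    have h4 : ε / (l * (W + 1)) * φ u * (l * (d - c)) ≤ ε := by
      have : ε / (l * (W + 1)) * φ u * (l * (d - c)) = ε * (φ u * (d - c)) / (W + 1) := by
        field_simp
      rw [this, div_le_iff₀ (by positivity)]
      exact mul_le_mul_of_nonneg_left (h1.trans (by linarith)) hε.le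
    rw [h3, abs_of_pos hdc]
    have h5 := mul_le_mul_of_nonneg_right h2 (show 0 ≤ l * (d - c) by positivity)
    linarith
  refine ⟨l * C, by positivity, fun c hc d hd => ?_⟩
  rcases lt_trichotomy c d with h | rfl | h
  · exact key c d hc.1 h hd.2
  · simpa using hε.le
  · rw [abs_sub_comm, abs_sub_comm d c]
    exact key d c hd.1 h hc.2

theorem continuousOn_of_mem_GVPhiAt {φ : ℝ → ℝ} (hφ : IsConvexPhiFunction φ)
    (hO : OrliczAtInfinity φ) {a b x₀ : ℝ} {x : ℝ → ℝ} (hx : x ∈ GVPhiAt φ a b x₀) :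
    ContinuousOn x (Icc a b) := by
  obtain ⟨⟨l, hl, hx⟩, -⟩ := hx
  refine Metric.continuousOn_iff.2 fun c hc ε hε => ?_
  obtain ⟨C, hC, h⟩ := exists_abs_sub_le_of_phiVarModular_lt_top hφ hO hl hx (half_pos hε)
  refine ⟨ε / (2 * (C + 1)), by positivity, fun d hd hdc => ?_⟩
  rw [Real.dist_eq] at hdc ⊢
  rw [lt_div_iff₀ (by positivity)] at hdc
  have := h c hc d hd
  have := abs_nonneg (d - c)
  rcases this.eq_or_lt with h0 | h0
  · rw [← h0] at *; linarith
  · nlinarith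

/-- Superposition of a function that is measurable in the first and continuous in the second
variable with a measurable function. -/
theorem aemeasurable_superposition {μ : Measure ℝ} {f : ℝ → ℝ → ℝ}
    (hf : ∀ u : ℝ, AEMeasurable (fun t => f t u) μ) (hc : ∀ᵐ t ∂μ, Continuous (f t))
    {x : ℝ → ℝ} (hx : AEMeasurable x μ) : AEMeasurable (fun t => f t (x t)) μ := by
  have hfloor : ∀ n : ℕ, AEMeasurable
      (fun t => f t ((⌊x t * (n + 1 : ℝ)⌋ : ℝ) / (n + 1 : ℝ))) μ := by
    intro n
    let F : ℤ × ℝ → ℝ := fun p => (hf ((p.1 : ℝ) / (n + 1 : ℝ))).mk _ p.2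
    have hF : Measurable F :=
      measurable_from_prod_countable_right fun k => (hf ((k : ℝ) / (n + 1 : ℝ))).measurable_mk
    have hk : Measurable fun t => ⌊hx.mk x t * (n + 1 : ℝ)⌋ :=
      (hx.measurable_mk.mul_const _).floor
    refine ⟨fun t => F (⌊hx.mk x t * (n + 1 : ℝ)⌋, t), hF.comp (hk.prodMk measurable_id), ?_⟩
    have hall : ∀ᵐ t ∂μ, ∀ k : ℤ, f t ((k : ℝ) / (n + 1 : ℝ)) = F (k, t) :=
      ae_all_iff.2 fun k => (hf ((k : ℝ) / (n + 1 : ℝ))).ae_eq_mk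
    filter_upwards [hall, hx.ae_eq_mk] with t ht hxt
    rw [ht, hxt]
  refine aemeasurable_of_tendsto_metrizable_ae atTop hfloor ?_
  filter_upwards [hc] with t ht
  refine (ht.tendsto _).comp ?_
  have h1 : Tendsto (fun n : ℕ => x t - 1 / ((n : ℝ) + 1)) atTop (nhds (x t)) := by
    simpa using tendsto_const_nhds.sub (tendsto_one_div_add_atTop_nhds_zero_nat (𝕜 := ℝ))
  refine tendsto_of_tendsto_of_tendsto_of_le_of_le h1 tendsto_const_nhds ?_ ?_
  · intro n
    have hn : (0 : ℝ) < n + 1 := by positivity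
    have := Int.sub_one_lt_floor (x t * (n + 1 : ℝ))
    show x t - 1 / ((n : ℝ) + 1) ≤ (⌊x t * (n + 1 : ℝ)⌋ : ℝ) / (n + 1 : ℝ)
    rw [le_div_iff₀ hn, sub_mul, one_div_mul_cancel hn.ne']
    exact this.le
  · intro n
    have hn : (0 : ℝ) < n + 1 := by positivity
    show (⌊x t * (n + 1 : ℝ)⌋ : ℝ) / (n + 1 : ℝ) ≤ x t
    rw [div_le_iff₀ hn]
    exact Int.floor_le _

/-- Jensen's inequality on an interval. -/
theorem ofReal_phi_integral_le {φ : ℝ → ℝ} (hφ : IsConvexPhiFunction φ) {c d l : ℝ}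
    (hcd : c < d) {g : ℝ → ℝ} (hg : IntegrableOn g (Ioc c d)) (hl : 0 < l) :
    ENNReal.ofReal (φ (|∫ s in Ioc c d, g s| / (l * (d - c))) * (d - c))
      ≤ ∫⁻ s in Ioc c d, ENNReal.ofReal (φ |g s / l|) := by
  have hdc : 0 < d - c := sub_pos.2 hcd
  have hgl : IntegrableOn (fun s => g s / l) (Ioc c d) := hg.div_const l
  by_cases hfin : ∫⁻ s in Ioc c d, ENNReal.ofReal (φ |g s / l|) = ∞
  · rw [hfin]; exact le_top
  have hint : IntegrableOn (fun s => φ |g s / l|) (Ioc c d) := by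
    refine ⟨hφ.continuous_comp_abs.comp_aestronglyMeasurable hgl.1, ?_⟩
    rw [hasFiniteIntegral_iff_ofReal (ae_of_all _ fun s => hφ.nonneg _ (abs_nonneg _))]
    exact lt_top_iff_ne_top.2 hfin
  have hvol : volume.real (Ioc c d) = d - c := by
    rw [Real.volume_real_Ioc_of_le hcd.le]
  have hJ := hφ.convexOn_comp_abs.map_set_average_le hφ.continuous_comp_abs.continuousOn
    isClosed_univ (by simp [hcd]) (by simp) (ae_of_all _ fun s => mem_univ _) hgl hint
  rw [setAverage_eq, setAverage_eq, hvol, integral_div, smul_eq_mul, smul_eq_mul,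
    abs_mul, abs_div, abs_of_pos hl, abs_of_pos (inv_pos.2 hdc)] at hJ
  rw [← ofReal_integral_eq_lintegral_ofReal hint
    (ae_of_all _ fun s => hφ.nonneg _ (abs_nonneg _))]
  refine ENNReal.ofReal_le_ofReal ?_
  rw [← le_div_iff₀ hdc, div_eq_inv_mul (∫ s in Ioc c d, φ |g s / l|)]
  refine le_of_eq_of_le (congrArg φ ?_) hJ
  field_simp

/-- The modular distance of two functions that differ by a primitive of `g` is at most the
Orlicz modular of `g / l`. -/
theorem phiVarModular_le_orliczModular {φ : ℝ → ℝ} (hφ : IsConvexPhiFunction φ) {a b l : ℝ}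
    {g : ℝ → ℝ} (hg : IntegrableOn g (Ioc a b)) (hl : 0 < l) {X Y : ℝ → ℝ}
    (hXY : ∀ c d, a ≤ c → c ≤ d → d ≤ b →
      (X d + Y c) - (X c + Y d) = ∫ s in Ioc c d, g s) :
    phiVarModular φ a b l X Y ≤ orliczModular φ a b (fun s => g s / l) := by
  unfold phiVarModular orliczModular
  refine iSup_le fun m => iSup_le fun t => iSup_le fun ht => ?_
  rw [Measure.restrict_congr_set Ioc_ae_eq_Icc.symm, ← ht.sum_setLIntegral]
  refine Finset.sum_le_sum fun i hi => ?_
  have hi := Finset.mem_range.1 hi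
  have h0 := ht.left_le i hi.le
  have h1 := ht.le_right (Nat.succ_le_of_lt hi)
  rw [hXY _ _ h0 (ht.lt i hi).le h1]
  exact ofReal_phi_integral_le hφ (ht.lt i hi) (hg.mono_set (Ioc_subset_Ioc h0 h1)) hl

theorem MemOrlicz.integrableOn {φ : ℝ → ℝ} (hφ : IsConvexPhiFunction φ)
    (hO : OrliczAtInfinity φ) {a b : ℝ} {z : ℝ → ℝ} (hz : MemOrlicz φ a b z) :
    IntegrableOn z (Icc a b) := by
  obtain ⟨hm, l, hl, hfin⟩ := hz
  obtain ⟨C, hC, hCu⟩ := hφ.exists_le_mul_add hO one_pos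
  have hint : IntegrableOn (fun s => φ |z s / l|) (Icc a b) := by
    refine ⟨hφ.continuous_comp_abs.comp_aestronglyMeasurable
      (hm.div_const l).aestronglyMeasurable, ?_⟩
    rw [hasFiniteIntegral_iff_ofReal (ae_of_all _ fun s => hφ.nonneg _ (abs_nonneg _))]
    exact hfin
  have hbd : IntegrableOn (fun s => l * (φ |z s / l| + C)) (Icc a b) :=
    (hint.add (integrableOn_const (by simp))).const_mul l
  refine Integrable.mono' hbd hm.aestronglyMeasurable (ae_of_all _ fun s => ?_)
  have h := hCu |z s / l| (abs_nonneg _)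
  rw [one_mul, abs_div, abs_of_pos hl, div_le_iff₀ hl] at h
  rw [Real.norm_eq_abs, abs_div, abs_of_pos hl]
  linarith

/-- The Orlicz space contains with `z` every function bounded by `|z|` plus a constant. -/
theorem MemOrlicz.of_abs_le_add {φ : ℝ → ℝ} (hφ : IsConvexPhiFunction φ) {a b K : ℝ}
    {z g : ℝ → ℝ} (hz : MemOrlicz φ a b z)
    (hg : AEMeasurable g (volume.restrict (Icc a b)))
    (hgz : ∀ᵐ t ∂(volume.restrict (Icc a b)), |g t| ≤ |z t| + K) :
    MemOrlicz φ a b g := by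
  obtain ⟨-, l, hl, hfin⟩ := hz
  refine ⟨hg, 2 * l, by positivity, ?_⟩
  unfold orliczModular at *
  have hle : ∀ᵐ t ∂(volume.restrict (Icc a b)), ENNReal.ofReal (φ |g t / (2 * l)|)
      ≤ ENNReal.ofReal (φ |z t / l|) + ENNReal.ofReal (φ |K / l|) := by
    filter_upwards [hgz] with t ht
    rw [← ENNReal.ofReal_add (hφ.nonneg _ (abs_nonneg _)) (hφ.nonneg _ (abs_nonneg _))]
    refine ENNReal.ofReal_le_ofReal ?_
    have h1 := hφ.convexOn.2 (abs_nonneg (z t / l)) (abs_nonneg (K / l))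
      (show (0 : ℝ) ≤ 1 / 2 by norm_num) (show (0 : ℝ) ≤ 1 / 2 by norm_num) (by norm_num)
    simp only [smul_eq_mul] at h1
    have h2 : φ |g t / (2 * l)| ≤ φ (1 / 2 * |z t / l| + 1 / 2 * |K / l|) := by
      refine hφ.monotoneOn (mem_Ici.2 (abs_nonneg _))
        (show (0 : ℝ) ≤ 1 / 2 * |z t / l| + 1 / 2 * |K / l| by positivity) ?_
      rw [abs_div, abs_div, abs_div, abs_of_pos hl, abs_of_pos (show 0 < 2 * l by positivity),
        div_le_iff₀ (by positivity)]
      have : (1 / 2 * (|z t| / l) + 1 / 2 * (|K| / l)) * (2 * l) = |z t| + |K| := by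
        field_simp
      rw [this]
      linarith [le_abs_self K]
    have h3 := hφ.nonneg _ (abs_nonneg (z t / l))
    have h4 := hφ.nonneg _ (abs_nonneg (K / l))
    linarith
  refine (lintegral_mono_ae hle).trans_lt ?_
  rw [lintegral_add_right _ measurable_const]
  refine ENNReal.add_lt_top.2 ⟨hfin, ?_⟩
  rw [setLIntegral_const]
  exact ENNReal.mul_lt_top ENNReal.ofReal_lt_top (by simp)

/-- The superposition operator maps `GV_φ` into `L^φ`. -/
theorem memOrlicz_superposition {φ : ℝ → ℝ} (hφ : IsConvexPhiFunction φ)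
    (hO : OrliczAtInfinity φ) {a b : ℝ} {f : ℝ → ℝ → ℝ}
    (hmeas : ∀ x : ℝ, AEMeasurable (fun t => f t x) (volume.restrict (Icc a b)))
    {y₀ : ℝ} (hy₀ : MemOrlicz φ a b (fun t => f t y₀)) {L : ℝ} (hL : 0 < L)
    (hLip : ∀ᵐ t ∂(volume.restrict (Icc a b)), ∀ x y : ℝ, |f t x - f t y| ≤ L * |x - y|)
    {x₀ : ℝ} {x : ℝ → ℝ} (hx : x ∈ GVPhiAt φ a b x₀) :
    MemOrlicz φ a b (fun t => f t (x t)) := by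
  have hxc := continuousOn_of_mem_GVPhiAt hφ hO hx
  obtain ⟨K, hK⟩ := isCompact_Icc.exists_bound_of_continuousOn
    (hxc.sub (continuousOn_const (c := y₀)))
  refine hy₀.of_abs_le_add hφ (K := L * K)
    (aemeasurable_superposition hmeas ?_ (hxc.aemeasurable measurableSet_Icc)) ?_
  · filter_upwards [hLip] with t ht
    refine (LipschitzWith.of_dist_le_mul (K := ⟨L, hL.le⟩) fun u v => ?_).continuous
    exact ht u v
  · filter_upwards [hLip, ae_restrict_mem measurableSet_Icc] with t ht hmem
    have h1 := ht (x t) y₀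
    have h2 : |x t - y₀| ≤ K := hK t hmem
    have h3 := mul_le_mul_of_nonneg_left h2 hL.le
    have h4 := abs_sub_abs_le_abs_sub (f t (x t)) (f t y₀)
    linarith

theorem integralOp_sub_integralOp {f : ℝ → ℝ → ℝ} {a b x₀ : ℝ} {x : ℝ → ℝ}
    (hx : IntegrableOn (fun s => f s (x s)) (Ioc a b)) {c d : ℝ} (hac : a ≤ c) (hcd : c ≤ d)
    (hdb : d ≤ b) :
    integralOp f a x₀ x d - integralOp f a x₀ x c = ∫ s in Ioc c d, f s (x s) := by
  have hi : ∀ r, a ≤ r → r ≤ b → IntervalIntegrable (fun s => f s (x s)) volume a r :=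
    fun r har hrb => (intervalIntegrable_iff_integrableOn_Ioc_of_le har).2
      (hx.mono_set (Ioc_subset_Ioc_right hrb))
  rw [← intervalIntegral.integral_of_le hcd]
  unfold integralOp
  rw [add_sub_add_left_eq_sub, intervalIntegral.integral_interval_sub_left
    (hi d (hac.trans hcd) hdb) (hi c hac (hcd.trans hdb))]

/-- Functions in `GV_φ` with the same initial value are pointwise controlled by their modular
distance. -/
theorem ofReal_phi_abs_sub_le {φ : ℝ → ℝ} (hφ : IsConvexPhiFunction φ) {a b l : ℝ}
    (hab : a < b) (hl : 0 < l) {x y : ℝ → ℝ} (hxy : x a = y a) {s : ℝ} (hs : s ∈ Icc a b) :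
    ENNReal.ofReal (φ (|x s - y s| / ((b - a) * l)) * (b - a)) ≤ phiVarModular φ a b l x y := by
  have hba : 0 < b - a := sub_pos.2 hab
  rcases hs.1.eq_or_lt with rfl | has
  · simp [hxy, hφ.map_zero]
  have hsa : 0 < s - a := sub_pos.2 has
  refine le_trans (ENNReal.ofReal_le_ofReal ?_) (le_phiVarModular le_rfl has hs.2 l x y)
  have h1 : (x s + y a) - (x a + y s) = x s - y s := by rw [hxy]; ring
  rw [h1]
  have h2 := hφ.map_mul_le (r := (s - a) / (b - a)) (u := |x s - y s| / (l * (s - a)))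
    (by positivity) ((div_le_one hba).2 (by linarith [hs.2])) (by positivity)
  have h3 : (s - a) / (b - a) * (|x s - y s| / (l * (s - a))) = |x s - y s| / ((b - a) * l) := by
    field_simp
  rw [h3, div_mul_eq_mul_div, le_div_iff₀ hba] at h2
  linarith

theorem theorem6p1 (φ : ℝ → ℝ) (hφ : IsConvexPhiFunction φ) (hOrlicz : OrliczAtInfinity φ)
    (a b : ℝ) (hab : a < b) (f : ℝ → ℝ → ℝ)
    (hmeas : ∀ x : ℝ, AEMeasurable (fun t => f t x) (volume.restrict (Icc a b)))
    (hy₀ : ∃ y₀ : ℝ, MemOrlicz φ a b (fun t => f t y₀))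
    (L : ℝ) (hL : 0 < L)
    (hLip : ∀ᵐ t ∂(volume.restrict (Icc a b)), ∀ x y : ℝ, |f t x - f t y| ≤ L * |x - y|)
    (x₀ : ℝ) :
    (∀ x ∈ GVPhiAt φ a b x₀, IntervalIntegrable (fun s => f s (x s)) volume a b) ∧
    MapsTo (integralOp f a x₀) (GVPhiAt φ a b x₀) (GVPhiAt φ a b x₀) ∧
    ∀ l : ℝ, 0 < l → ∀ x ∈ GVPhiAt φ a b x₀, ∀ y ∈ GVPhiAt φ a b x₀,
      phiVarModular φ a b (L * (b - a) * l) (integralOp f a x₀ x) (integralOp f a x₀ y)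
        ≤ phiVarModular φ a b l x y := by
  obtain ⟨y₀, hy₀⟩ := hy₀
  have hba : 0 < b - a := sub_pos.2 hab
  have hmem : ∀ x ∈ GVPhiAt φ a b x₀, MemOrlicz φ a b (fun s => f s (x s)) := fun x hx =>
    memOrlicz_superposition hφ hOrlicz hmeas hy₀ hL hLip hx
  have hint : ∀ x ∈ GVPhiAt φ a b x₀, IntegrableOn (fun s => f s (x s)) (Ioc a b) :=
    fun x hx => ((hmem x hx).integrableOn hφ hOrlicz).mono_set Ioc_subset_Icc_self
  refine ⟨fun x hx => (intervalIntegrable_iff_integrableOn_Ioc_of_le hab.le).2 (hint x hx),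
    fun x hx => ?_, fun l hl x hx y hy => ?_⟩
  · obtain ⟨-, l, hl, hfin⟩ := hmem x hx
    refine ⟨⟨l, hl, lt_of_le_of_lt ?_ hfin⟩, by simp [integralOp]⟩
    refine phiVarModular_le_orliczModular hφ (hint x hx) hl fun c d hac hcd hdb => ?_
    rw [← integralOp_sub_integralOp (x₀ := x₀) (hint x hx) hac hcd hdb]
    ring
  · refine (phiVarModular_le_orliczModular hφ ((hint x hx).sub (hint y hy))
      (show 0 < L * (b - a) * l by positivity) fun c d hac hcd hdb => ?_).trans ?_
    · have hsub := Ioc_subset_Ioc hac hdb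
      simp only [Pi.sub_apply]
      rw [integral_sub ((hint x hx).mono_set hsub) ((hint y hy).mono_set hsub),
        ← integralOp_sub_integralOp (x₀ := x₀) (hint x hx) hac hcd hdb,
        ← integralOp_sub_integralOp (x₀ := x₀) (hint y hy) hac hcd hdb]
      ring
    · have hle : ∀ᵐ s ∂(volume.restrict (Icc a b)),
          ENNReal.ofReal (φ |(f s (x s) - f s (y s)) / (L * (b - a) * l)|)
            ≤ phiVarModular φ a b l x y / ENNReal.ofReal (b - a) := by
        filter_upwards [hLip, ae_restrict_mem measurableSet_Icc] with s hs hsm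
        rw [ENNReal.le_div_iff_mul_le (by simp [hab]) (by simp),
          ← ENNReal.ofReal_mul (hφ.nonneg _ (abs_nonneg _))]
        refine le_trans (ENNReal.ofReal_le_ofReal ?_)
          (ofReal_phi_abs_sub_le hφ hab hl (hx.2.trans hy.2.symm) hsm)
        refine mul_le_mul_of_nonneg_right (hφ.monotoneOn (mem_Ici.2 (abs_nonneg _))
          (show (0 : ℝ) ≤ |x s - y s| / ((b - a) * l) by positivity) ?_) hba.le
        rw [abs_div, abs_of_pos (show 0 < L * (b - a) * l by positivity), mul_assoc,
          ← div_div]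
        refine div_le_div_of_nonneg_right ?_ (by positivity)
        rw [div_le_iff₀' hL]
        exact hs _ _
      refine (lintegral_mono_ae hle).trans ?_
      rw [setLIntegral_const, Real.volume_Icc, ENNReal.div_mul_cancel (by simp [hab]) (by simp)]
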